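/- Let $n\ge 4$, $M\ge 2$, let $Y=f+\varepsilon$ in $\mathbb R^n$ with $f\in\mathbb R^n$ and $\varepsilon_1,\dots,\varepsilon_n$ independent $\mathcal N(0,\sigma^2)$ variables, $\sigma>0$ unknown, and let $\phi_1,\dots,\phi_M\in\mathbb R^n$ be fixed. For nonempty $m\subset\{1,\dots,M\}$ put $S_m=\mathrm{span}\{\phi_j:j\in m\}$ and $\Delta(m)=|m|+\log\binom M{|m|}$. For $\dim S_m\le n-2$, let $\mathrm{pen}_\Delta(m)\ge 0$ be the solution $x$ of $E\big[(U-\tfrac{x}{n-\dim S_m}V)_+\big]=e^{-\Delta(m)}$, where $U,V$ are independent $\chi^2$ variables with $\dim S_m+1$ and $n-\dim S_m-1$ degrees of freedom, and let $\mathrm{pen}(m)=1.1\,\mathrm{pen}_\Delta(m)$. Write $\Pi_S$ for the orthogonal projection onto $S$ and $\widehat\sigma^2_m=\|Y-\Pi_{S_m}Y\|^2/(n-\dim S_m)$. Let $\mathcal M_{\rm L}=\{\{1,\dots,M\}\}$, $\mathcal M_{\rm MS}=\{\{1\},\dots,\{M\}\}$ and $\mathcal M_{\rm Cv}=\{m\neq\varnothing: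 |m|\le n/(2\log(eM))\}$. Given estimators $\widehat f_{\rm L},\widehat f_{\rm MS},\widehat f_{\rm Cv}$, choose $\widehat\lambda\in\{{\rm L},{\rm MS},{\rm Cv}\}$ minimizing $$\mathrm{crit}(\lambda)=\min_{m\in\mathcal M_\lambda}\Big[\|Y-\Pi_{S_m}\widehat f_\lambda\|^2+\tfrac12\|\widehat f_\lambda-\Pi_{S_m}\widehat f_\lambda\|^2+\mathrm{pen}(m)\,\widehat\sigma^2_m\Big].$$ Let $L=\sup_j\|\phi_j\|/(\sigma\sqrt n)$, and assume $\dim \mathrm{span}\{\phi_1,\dots,\phi_M\}\le n-2$, $\log(eM)\le n/2$ and $$2\le\sqrt n L\le M\le e^{-1}\min\{\sqrt nLe^{nL^2},\,e^{\sqrt n/(2L)}\}.$$ Put $B_{\rm L}=\sigma^2M$, $B_{\rm MS}=\sigma^2\log M$ and $B_{\rm Cv}=\sigma^2\big[M\wedge\sqrt{nL^2\log(eM/\sqrt{nL^2})}\big]$. For $0<\kappa<1$ let $\Lambda_\kappa=\{{\rm L},{\rm MS},{\rm Cv}\}$ if $M\le\kappa n$ and $\Lambda_\kappa=\{{\rm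 MS},{\rm Cv}\}$ otherwise. Then for every $\kappa\in(0,1)$ there is a constant $C>0$ depending only on $\kappa$ (so a numerical constant for $\kappa=1/2$) such that, for all $n,M,\sigma,\phi,f$ as above and whatever $\widehat f_{\rm L},\widehat f_{\rm MS},\widehat f_{\rm Cv}$ with values in $\mathrm{span}\{\phi_1,\dots,\phi_M\}$, $\bigcup_j\mathrm{span}\{\phi_j\}$ and $\mathrm{conv}\{\phi_1,\dots,\phi_M\}$ respectively, $$C\,E\|f-\widehat f_{\widehat\lambda}\|^2\le\min_{\lambda\in\Lambda_\kappa}\big[E\|f-\widehat f_\lambda\|^2+B_\lambda\big].$$ In particular, let $\mathbb F_{\rm L}$, $\mathbb F_{\rm MS}$, $\mathbb F_{\rm Cv}$ be the linear span of the $\phi_j$, the set $\{\phi_1,\dots,\phi_M\}$ and the convex hull of the $\phi_j$. For every $C'>0$ there is $C''>0$ depending only on $\kappa$ and $C'$ such that, if $E\|f-\widehat f_\lambda\|^2\le\inf_{g\in\mathbb F_\lambda}\|f-g\|^2+C'B_\lambda$ for all $\lambda\in\Lambda_\kappa$, then $$C''\,E\|f-\widehat f_{\widehat\lambda}\|^2\le\min_{\lambda\in\Lambda_\kappa}\Big[\inf_{g\in\mathbb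 F_\lambda}\|f-g\|^2+B_\lambda\Big].$$ -/

import Mathlib

open MeasureTheory ProbabilityTheory
open scoped ENNReal

noncomputable section

namespace GaussianAggregation

/-- The three aggregation problems: linear, model selection, convex. -/
inductive Problem where
  | L
  | MS
  | Cv

/-- The law of a `χ²` random variable with `k` degrees of freedom: the law of the sum of the
squares of `k` independent standard Gaussian variables. -/
def chiSq (k : ℕ) : Measure ℝ :=
  (Measure.pi fun _ : Fin k => gaussianReal 0 1).map fun z => ∑ i, z i ^ 2

/-- The penalty `pen_Δ` of a space of dimension `D` in `ℝⁿ` with weight `Δ`: the solution `x ≥ 0` of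
`E[(U - x V / (n - D))₊] = exp (-Δ)`, with `U`, `V` independent `χ²` variables with
`D + 1` and `n - D - 1` degrees of freedom.
For `D + 2 ≤ n` and `Δ > 0` the solution exists and is unique. -/
def penDelta (n D : ℕ) (Δ : ℝ) : ℝ :=
  sInf {x : ℝ | 0 ≤ x ∧
    ∫ p, max (p.1 - x / ((n : ℝ) - D) * p.2) 0 ∂((chiSq (D + 1)).prod (chiSq (n - D - 1)))
      = Real.exp (-Δ)}

variable {n M : ℕ}

/-- The space `S_m`, spanned by the `φ_j`, `j ∈ m`. -/
def space (φ : Fin M → EuclideanSpace ℝ (Fin n)) (m : Finset (Fin M)) :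
    Submodule ℝ (EuclideanSpace ℝ (Fin n)) :=
  Submodule.span ℝ (φ '' (m : Set (Fin M)))

/-- The weight `Δ(S_m) = |m| + log (M choose |m|)`. -/
def weight (m : Finset (Fin M)) : ℝ :=
  (m.card : ℝ) + Real.log (M.choose m.card)

/-- The penalty `pen(S_m) = 1.1 pen_Δ(S_m)`. -/
def pen (φ : Fin M → EuclideanSpace ℝ (Fin n)) (m : Finset (Fin M)) : ℝ :=
  (11 / 10 : ℝ) * penDelta n (Module.finrank ℝ (space φ m)) (weight m)

/-- The variance estimator `‖y - Π_S y‖² / (n - dim S)`, with `S = S_m`. -/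
def varEst (φ : Fin M → EuclideanSpace ℝ (Fin n)) (m : Finset (Fin M))
    (y : EuclideanSpace ℝ (Fin n)) : ℝ :=
  ‖y - (space φ m).starProjection y‖ ^ 2 / ((n : ℝ) - Module.finrank ℝ (space φ m))

/-- The (index sets `m` of the) families of spaces `S_m` attached to the three estimators:
the full index set; the singletons; the nonempty `m` with `|m| ≤ n / (2 log (e M))`. -/
def family (n M : ℕ) : Problem → Set (Finset (Fin M))
  | .L => {Finset.univ}
  | .MS => {m | ∃ j, m = {j}}
  | .Cv => {m | m.Nonempty ∧ (m.card : ℝ) ≤ (n : ℝ) / (2 * Real.log (Real.exp 1 * M))}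

/-- The selection criterion, with `α = 1/2`, of an estimator with value `g` attached to the family
of the problem `lam`, when the observation is `y`. -/
def crit (φ : Fin M → EuclideanSpace ℝ (Fin n)) (lam : Problem)
    (y g : EuclideanSpace ℝ (Fin n)) : ℝ :=
  ⨅ m : family n M lam,
    (‖y - (space φ m).starProjection g‖ ^ 2
      + (1 / 2 : ℝ) * ‖g - (space φ m).starProjection g‖ ^ 2
      + pen φ m * varEst φ m y)

/-- The sets in which the three estimators take their values: the linear span of the `φ_j`,
the union of the lines spanned by the `φ_j`, the convex hull of the `φ_j`. -/
def valueSet (φ : Fin M → EuclideanSpace ℝ (Fin n)) : Problem → Set (EuclideanSpace ℝ (Fin n))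
  | .L => space φ Finset.univ
  | .MS => ⋃ j, (space φ {j} : Set (EuclideanSpace ℝ (Fin n)))
  | .Cv => convexHull ℝ (Set.range φ)

/-- The coefficient sets `Λ_L`, `Λ_MS`, `Λ_Cv`. -/
def coeffs (M : ℕ) : Problem → Set (Fin M → ℝ)
  | .L => Set.univ
  | .MS => {c | (∀ j, c j = 0 ∨ c j = 1) ∧ ∑ j, c j = 1}
  | .Cv => {c | (∀ j, 0 ≤ c j) ∧ ∑ j, c j = 1}

/-- The infimum of `‖f - g‖²` over the `g = ∑ c_j φ_j` with `c` in the coefficient set. -/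
def bias (φ : Fin M → EuclideanSpace ℝ (Fin n)) (f : EuclideanSpace ℝ (Fin n))
    (lam : Problem) : ℝ :=
  ⨅ c : coeffs M lam, ‖f - ∑ j, c.1 j • φ j‖ ^ 2

/-- `L = sup_j ‖φ_j‖ / (σ √n)`. -/
def relNorm (φ : Fin M → EuclideanSpace ℝ (Fin n)) (σ : ℝ) : ℝ :=
  ⨆ j, ‖φ j‖ / (σ * √(n : ℝ))

/-- The condition
`2 ≤ √n L ≤ M ≤ e⁻¹ min {√n L exp (n L²), exp (√n / (2 L))}`. -/
def HM (n M : ℕ) (L : ℝ) : Prop :=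
  2 ≤ √(n : ℝ) * L ∧ √(n : ℝ) * L ≤ M ∧
    (M : ℝ) ≤ (Real.exp 1)⁻¹ *
      min (√(n : ℝ) * L * Real.exp (n * L ^ 2)) (Real.exp (√(n : ℝ) / (2 * L)))

/-- The remainder terms `B_L`, `B_MS`, `B_Cv`. -/
def remainder (n M : ℕ) (σ L : ℝ) : Problem → ℝ
  | .L => σ ^ 2 * M
  | .MS => σ ^ 2 * Real.log M
  | .Cv => σ ^ 2 * min (M : ℝ)
      √(n * L ^ 2 * Real.log (Real.exp 1 * M / √(n * L ^ 2)))

/-- The quadratic risk `E ‖f - fhat‖²`, possibly infinite. -/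
def risk {Ω : Type*} [MeasurableSpace Ω] (μ : Measure Ω) (f : EuclideanSpace ℝ (Fin n))
    (fhat : Ω → EuclideanSpace ℝ (Fin n)) : ℝ≥0∞ :=
  ∫⁻ ω, ENNReal.ofReal (‖f - fhat ω‖ ^ 2) ∂μ

/-- The problems over which the infimum in the risk bound runs: all three when `M ≤ κ n`, and
`MS` and `Cv` otherwise. -/
def compared (κ : ℝ) (n M : ℕ) : Set Problem :=
  {lam | lam = .L → (M : ℝ) ≤ κ * n}

end GaussianAggregation

end

/-! The criterion of every estimator equals `‖ε‖²` plus its loss, up to constants and a small error;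
the unknown `‖ε‖²` is common to the three problems and cancels when criteria are compared.

For a space `S = S_m` of dimension `D`, take `T ⊇ S` of dimension `D + 1` containing `f`. If `p =
Π_S g`, then `f - p ∈ T`, so the noise meets the loss only through `Π_T ε`, while the residual `‖Y -
Π_S Y‖²` is at least `‖ε - Π_T ε‖²`. These two squared norms are `σ²` times independent `χ²`
variables with `D + 1` and `n - D - 1` degrees of freedom, which is why the penalty is defined by
them: the slope `t = pen_Δ / (n - D)` makes the expected excess `(‖Π_T ε‖² - t ‖ε - Π_T ε‖²)₊` equal
to `σ² exp (-Δ)`. Since `∑ exp (-Δ(m)) ≤ 2`, the sum `Z` of all excesses has mean at most `2σ²`.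
Bounding by `Z` pointwise requires no independence between the estimators and the noise.

`loss_le_residual` and `residual_le_loss` give the two deterministic comparisons. It remains to
exhibit, for any value `g` of a compared estimator, one space of its family with `‖g - Π_S g‖²` and
`σ² (Δ + D + 1)` of order `B_λ` (`exists_family`). For L and MS the space contains `g`; for Cv,
Maurey's argument gives a sparse approximation whose sparsity balances the two terms. A Chernoff
bound on the excess (`penDelta_spec`, `slope_le`) shows that `t` is of order `(Δ + D + 1) / n`, so
the variance term `t ‖ε‖²` has mean of order `B_λ`. -/

open scoped RealInnerProductSpace

namespace GaussianAggregation

/-! ### Chi-square laws, the excess function and the size of the penalty -/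

section ChiSquare

instance isProbabilityMeasure_chiSq (k : ℕ) : IsProbabilityMeasure (chiSq k) :=
  Measure.isProbabilityMeasure_map (Measurable.aemeasurable (by fun_prop))

lemma ae_nonneg_chiSq (k : ℕ) : ∀ᵐ x ∂chiSq k, 0 ≤ x := by
  rw [chiSq, ae_map_iff (Measurable.aemeasurable (by fun_prop)) measurableSet_Ici]
  exact ae_of_all _ fun z => Finset.sum_nonneg fun i _ => sq_nonneg _

lemma integrable_sq_gaussianReal (v : NNReal) :
    Integrable (fun x : ℝ => x ^ 2) (gaussianReal 0 v) :=
  (memLp_id_gaussianReal (μ := 0) (v := v) 2).integrable_sq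

lemma integral_sq_gaussianReal (v : NNReal) : ∫ x, x ^ 2 ∂gaussianReal 0 v = v := by
  have h := variance_id_gaussianReal (μ := 0) (v := v)
  rw [variance_of_integral_eq_zero (by fun_prop) (by simp)] at h
  simpa using h

lemma integrable_sq_eval {k : ℕ} (i : Fin k) :
    Integrable (fun z : Fin k → ℝ => z i ^ 2) (Measure.pi fun _ => gaussianReal 0 1) :=
  integrable_comp_eval (μ := fun _ : Fin k => gaussianReal 0 1) (f := fun x : ℝ => x ^ 2)
    (integrable_sq_gaussianReal 1)

lemma integrable_id_chiSq (k : ℕ) : Integrable (fun x => x) (chiSq k) := by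
  rw [chiSq, integrable_map_measure (by fun_prop) (Measurable.aemeasurable (by fun_prop))]
  exact integrable_finsetSum _ fun i _ => integrable_sq_eval i

lemma integral_id_chiSq (k : ℕ) : ∫ x, x ∂chiSq k = k := by
  rw [chiSq, integral_map (Measurable.aemeasurable (by fun_prop)) (by fun_prop),
    integral_finsetSum _ fun i _ => integrable_sq_eval i]
  simp_rw [integral_comp_eval (μ := fun _ : Fin k => gaussianReal 0 1)
    (f := fun x : ℝ => x ^ 2) (by fun_prop), integral_sq_gaussianReal]
  simp

lemma integral_exp_sq_gaussianReal {s : ℝ} (hs : s < 1 / 2) :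
    ∫ x, Real.exp (s * x ^ 2) ∂gaussianReal 0 1 = (√(1 - 2 * s))⁻¹ := by
  rw [integral_gaussianReal_eq_integral_smul one_ne_zero]
  have h : ∀ x : ℝ, gaussianPDFReal 0 1 x • Real.exp (s * x ^ 2)
      = (√(2 * Real.pi))⁻¹ * Real.exp (-(1 / 2 - s) * x ^ 2) := by
    intro x
    rw [gaussianPDFReal, smul_eq_mul]
    simp only [NNReal.coe_one, mul_one, sub_zero]
    rw [mul_assoc, ← Real.exp_add]
    congr 2
    ring
  simp_rw [h]
  rw [integral_const_mul, integral_gaussian, ← Real.sqrt_inv, ← Real.sqrt_inv,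
    ← Real.sqrt_mul (by positivity)]
  congr 1
  have h1 : 1 / 2 - s ≠ 0 := by linarith
  have h2 : 1 - 2 * s ≠ 0 := by linarith
  field_simp

lemma integral_exp_chiSq (k : ℕ) {s : ℝ} (hs : s < 1 / 2) :
    ∫ x, Real.exp (s * x) ∂chiSq k = (√(1 - 2 * s))⁻¹ ^ k := by
  rw [chiSq, integral_map (Measurable.aemeasurable (by fun_prop)) (by fun_prop)]
  simp_rw [Finset.mul_sum, Real.exp_sum]
  rw [integral_fintype_prod_eq_pow (ι := Fin k) (fun x : ℝ => Real.exp (s * x ^ 2)),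
    integral_exp_sq_gaussianReal hs, Fintype.card_fin]

lemma integrable_exp_chiSq (k : ℕ) {s : ℝ} (hs : s < 1 / 2) :
    Integrable (fun x => Real.exp (s * x)) (chiSq k) := by
  -- The Bochner integral of a non-integrable function is `0`, so the nonzero value computed above
  -- already forces integrability.
  refine .of_integral_ne_zero ?_
  rw [integral_exp_chiSq k hs]
  have : 0 < 1 - 2 * s := by linarith
  positivity

/-- The excess `E[(U - t V)₊]` for independent `χ²` variables `U`, `V` with `a` and `b` degrees of
freedom. -/
noncomputable def excess (a b : ℕ) (t : ℝ) : ℝ :=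
  ∫ p, max (p.1 - t * p.2) 0 ∂((chiSq a).prod (chiSq b))

lemma integrable_excess (a b : ℕ) (t : ℝ) :
    Integrable (fun p : ℝ × ℝ => max (p.1 - t * p.2) 0) ((chiSq a).prod (chiSq b)) :=
  (((integrable_id_chiSq a).comp_fst _).sub
    (((integrable_id_chiSq b).comp_snd _).const_mul t)).pos_part

lemma excess_zero (a b : ℕ) : excess a b 0 = a := by
  have h : excess a b 0 = ∫ p : ℝ × ℝ, p.1 ∂((chiSq a).prod (chiSq b)) := by
    refine integral_congr_ae ?_
    have := (Measure.quasiMeasurePreserving_fst (μ := chiSq a) (ν := chiSq b)).ae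
      (ae_nonneg_chiSq a)
    filter_upwards [this] with p hp
    simp [hp]
  rw [h, integral_fun_fst (fun x : ℝ => x), integral_id_chiSq]
  simp

/-- The integrand is Lipschitz in `t` with constant `V`, and `E V = b`. The resulting continuity
serves the intermediate value theorem. -/
lemma abs_excess_sub_le (a b : ℕ) (s t : ℝ) : |excess a b s - excess a b t| ≤ b * |s - t| := by
  have hi : Integrable (fun p : ℝ × ℝ => |s - t| * p.2) ((chiSq a).prod (chiSq b)) :=
    ((integrable_id_chiSq b).comp_snd _).const_mul _
  rw [excess, excess, ← integral_sub (integrable_excess a b s) (integrable_excess a b t),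
    ← Real.norm_eq_abs]
  refine (norm_integral_le_of_norm_le hi ?_).trans_eq ?_
  · have := (Measure.quasiMeasurePreserving_snd (μ := chiSq a) (ν := chiSq b)).ae
      (ae_nonneg_chiSq b)
    filter_upwards [this] with p hp
    refine (abs_max_sub_max_le_abs _ _ _).trans_eq ?_
    rw [show p.1 - s * p.2 - (p.1 - t * p.2) = -((s - t) * p.2) by ring, abs_neg, abs_mul,
      abs_of_nonneg hp]
  · rw [integral_const_mul, integral_fun_snd (fun x : ℝ => x), integral_id_chiSq]
    simp [mul_comm]

lemma continuous_excess (a b : ℕ) : Continuous (excess a b) := by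
  refine (LipschitzWith.of_dist_le_mul (K := b) fun s t => ?_).continuous
  simpa [Real.dist_eq] using abs_excess_sub_le a b s t

/-- Chernoff bound: `x₊ ≤ (4 / e) exp (x / 4)`, and the exponential moments of independent `χ²`
variables factor. -/
lemma excess_le (a b : ℕ) {t : ℝ} (ht : 0 ≤ t) :
    excess a b t ≤ 4 / Real.exp 1 * (√2 ^ a * (√(1 + t / 2))⁻¹ ^ b) := by
  have hb : -(t / 4) < 1 / 2 := by linarith
  have hi : Integrable (fun p : ℝ × ℝ => Real.exp (1 / 4 * p.1) * Real.exp (-(t / 4) * p.2))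
      ((chiSq a).prod (chiSq b)) :=
    (integrable_exp_chiSq a (by norm_num)).mul_prod (integrable_exp_chiSq b hb)
  calc excess a b t
      ≤ ∫ p, 4 / Real.exp 1 * (Real.exp (1 / 4 * p.1) * Real.exp (-(t / 4) * p.2))
          ∂((chiSq a).prod (chiSq b)) := by
        refine integral_mono (integrable_excess a b t) (hi.const_mul _) fun p => ?_
        refine max_le ?_ (by positivity)
        have h := Real.add_one_le_exp (1 / 4 * (p.1 - t * p.2) - 1)
        have h2 : Real.exp (1 / 4 * (p.1 - t * p.2) - 1)
            = Real.exp (1 / 4 * p.1) * Real.exp (-(t / 4) * p.2) / Real.exp 1 := by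
          rw [← Real.exp_add, ← Real.exp_sub]
          ring_nf
        rw [h2] at h
        have h3 : 4 / Real.exp 1 * (Real.exp (1 / 4 * p.1) * Real.exp (-(t / 4) * p.2))
          = 4 * (Real.exp (1 / 4 * p.1) * Real.exp (-(t / 4) * p.2) / Real.exp 1) := by ring
        rw [h3]
        linarith
    _ = _ := by
        rw [integral_const_mul, integral_prod_mul (fun x : ℝ => Real.exp (1 / 4 * x))
          (fun x : ℝ => Real.exp (-(t / 4) * x)), integral_exp_chiSq a (by norm_num),
          integral_exp_chiSq b hb, ← Real.sqrt_inv]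
        norm_num
        rw [show 2 * (t / 4) = t / 2 by ring]

/-- The argument is chosen so that `1 + t / 2 = exp (4 w / (n - D))` in the Chernoff bound, with `w
= Δ + D + 1`. The factor from `V` is then at most `exp (-w)`, and its part `exp (-(D + 1))` absorbs
`(4 / e) √2 ^ (D + 1)`. -/
lemma excess_le_exp_neg {n D : ℕ} (hD : D + 2 ≤ n) {Δ : ℝ} (hΔ : 0 ≤ Δ) :
    excess (D + 1) (n - D - 1)
      (2 * (Real.exp (4 * (Δ + D + 1) / ((n : ℝ) - D)) - 1)) ≤ Real.exp (-Δ) := by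
  set w := Δ + D + 1 with hw
  have hDn : (D : ℝ) + 2 ≤ n := by exact_mod_cast hD
  have hw0 : 0 ≤ w := by positivity
  have hN : (0 : ℝ) < (n : ℝ) - D := by linarith
  have hs : 0 ≤ 4 * w / ((n : ℝ) - D) := by positivity
  have h1 := Real.add_one_le_exp (4 * w / ((n : ℝ) - D))
  refine (excess_le _ _ (by linarith)).trans ?_
  have hb : ((n - D - 1 : ℕ) : ℝ) = (n : ℝ) - D - 1 := by
    rw [Nat.cast_sub (by omega), Nat.cast_sub (by omega)]; simp
  have e1 : √(1 + 2 * (Real.exp (4 * w / ((n : ℝ) - D)) - 1) / 2)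
      = Real.exp (2 * w / ((n : ℝ) - D)) := by
    rw [show 1 + 2 * (Real.exp (4 * w / ((n : ℝ) - D)) - 1) / 2
      = Real.exp (2 * w / ((n : ℝ) - D)) ^ 2 by
        rw [← Real.exp_nat_mul]; push_cast; ring_nf, Real.sqrt_sq (Real.exp_pos _).le]
  have e2 : √2 = Real.exp (Real.log 2 / 2) := by
    rw [Real.exp_half, Real.exp_log two_pos]
  have e3 : (4 : ℝ) = Real.exp (2 * Real.log 2) := by
    rw [two_mul, Real.exp_add, Real.exp_log two_pos]; norm_num
  rw [e1, e2, ← Real.exp_neg, ← Real.exp_nat_mul, ← Real.exp_nat_mul, ← Real.exp_add]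
  nth_rewrite 1 [e3]
  rw [← Real.exp_sub, ← Real.exp_add, Real.exp_le_exp, hb]
  have hl := Real.log_two_lt_d9
  -- Since `n - D ≥ 2`, losing one degree of freedom costs at most a factor `2`.
  have h5 : w ≤ ((n : ℝ) - D - 1) * (2 * w / ((n : ℝ) - D)) := by
    rw [mul_div_assoc', le_div_iff₀ hN]
    nlinarith
  have hD0 : (0 : ℝ) ≤ D := by positivity
  push_cast
  nlinarith

lemma penDelta_nonneg (n D : ℕ) (Δ : ℝ) : 0 ≤ penDelta n D Δ :=
  Real.sInf_nonneg fun _ hx => hx.1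

/-- The excess starts at `D + 1 ≥ exp (-Δ)` and is below `exp (-Δ)` at the Chernoff point, so a
solution lies between. -/
lemma penDelta_spec {n D : ℕ} (hD : D + 2 ≤ n) {Δ : ℝ} (hΔ : 0 ≤ Δ) :
    excess (D + 1) (n - D - 1) (penDelta n D Δ / ((n : ℝ) - D)) = Real.exp (-Δ) ∧
    penDelta n D Δ / ((n : ℝ) - D)
      ≤ 2 * (Real.exp (4 * (Δ + D + 1) / ((n : ℝ) - D)) - 1) := by
  set x₀ := 2 * (Real.exp (4 * (Δ + D + 1) / ((n : ℝ) - D)) - 1) with hx₀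
  have hDn : (D : ℝ) + 2 ≤ n := by exact_mod_cast hD
  have hN : (0 : ℝ) < (n : ℝ) - D := by linarith
  have h0 : 0 ≤ x₀ := by
    have := Real.add_one_le_exp (4 * (Δ + D + 1) / ((n : ℝ) - D))
    have : 0 ≤ 4 * (Δ + D + 1) / ((n : ℝ) - D) := by positivity
    linarith
  obtain ⟨t, ht, hte⟩ : Real.exp (-Δ) ∈ excess (D + 1) (n - D - 1) '' Set.Icc 0 x₀ := by
    refine intermediate_value_Icc' h0 (continuous_excess _ _).continuousOn
      ⟨excess_le_exp_neg hD hΔ, ?_⟩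
    rw [excess_zero]
    have : Real.exp (-Δ) ≤ 1 := Real.exp_le_one_iff.2 (by linarith)
    push_cast
    have : (0 : ℝ) ≤ D := by positivity
    linarith
  set A := {x : ℝ | 0 ≤ x ∧ excess (D + 1) (n - D - 1) (x / ((n : ℝ) - D)) = Real.exp (-Δ)}
  have hbdd : BddBelow A := ⟨0, fun _ hx => hx.1⟩
  have hmem : t * ((n : ℝ) - D) ∈ A :=
    ⟨mul_nonneg ht.1 hN.le, by rw [mul_div_assoc, div_self hN.ne', mul_one, hte]⟩
  have hcl : IsClosed A := isClosed_Ici.inter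
    (isClosed_eq ((continuous_excess _ _).comp (continuous_id.div_const _)) continuous_const)
  -- The solution set is closed, so its infimum is itself a solution; uniqueness is not needed.
  refine ⟨(hcl.csInf_mem ⟨_, hmem⟩ hbdd).2, ?_⟩
  rw [div_le_iff₀ hN]
  exact (csInf_le hbdd hmem).trans (mul_le_mul_of_nonneg_right ht.2 hN.le)

end ChiSquare

/-! ### Gaussian noise and its projections -/

section Gaussian

variable {n : ℕ}

lemma norm_sq_sum_smul {ι : Type*} [Fintype ι] {F : Type*} [NormedAddCommGroup F]
    [InnerProductSpace ℝ F] (b : OrthonormalBasis ι ℝ F) (x : ι → ℝ) :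
    ‖∑ i, x i • b i‖ ^ 2 = ∑ i, x i ^ 2 := by
  have h := b.sum_repr_symm (WithLp.toLp 2 x)
  simp only at h
  rw [h, LinearIsometryEquiv.norm_map, EuclideanSpace.real_norm_sq_eq]

/-- Under the standard Gaussian law, the squared norms of the two components of the decomposition
along a space of dimension `k` and its orthogonal are independent `χ²` variables. -/
lemma map_norm_sq_stdGaussian (T : Submodule ℝ (EuclideanSpace ℝ (Fin n))) {k : ℕ}
    (hk : Module.finrank ℝ T = k) :
    (stdGaussian (EuclideanSpace ℝ (Fin n))).map
      (fun x => (‖T.starProjection x‖ ^ 2, ‖x - T.starProjection x‖ ^ 2))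
      = (chiSq k).prod (chiSq (n - k)) := by
  have hk' : Module.finrank ℝ Tᗮ = n - k := by
    have := T.finrank_add_finrank_orthogonal
    rw [finrank_euclideanSpace_fin] at this
    omega
  let b₁ : OrthonormalBasis (Fin k) ℝ T := (stdOrthonormalBasis ℝ T).reindex (finCongr hk)
  let b₂ : OrthonormalBasis (Fin (n - k)) ℝ (Tᗮ : Submodule ℝ (EuclideanSpace ℝ (Fin n))) :=
    (stdOrthonormalBasis ℝ Tᗮ).reindex (finCongr hk')
  let b := (b₁.prod b₂).map T.orthogonalDecomposition.symm
  have hb1 : ∀ i, b (.inl i) = b₁ i := fun i => by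
    rw [OrthonormalBasis.map_apply, LinearIsometryEquiv.symm_apply_eq]
    rw [T.orthogonalDecomposition_apply, Submodule.orthogonalProjectionOnto_apply_of_mem_orthogonal
      (K := Tᗮ) (T.le_orthogonal_orthogonal (b₁ i).2)]
    simp
  have hb2 : ∀ i, b (.inr i) = b₂ i := fun i => by
    rw [OrthonormalBasis.map_apply, LinearIsometryEquiv.symm_apply_eq]
    rw [T.orthogonalDecomposition_apply, Submodule.orthogonalProjectionOnto_apply_of_mem_orthogonal
      (b₂ i).2]
    simp
  have hsum : ∀ x : Fin k ⊕ Fin (n - k) → ℝ, ∑ i, x i • b i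
      = ((∑ i, x (.inl i) • b₁ i : T) : EuclideanSpace ℝ (Fin n))
        + ((∑ i, x (.inr i) • b₂ i : (Tᗮ : Submodule ℝ (EuclideanSpace ℝ (Fin n)))) :
          EuclideanSpace ℝ (Fin n)) := fun x => by
    rw [Fintype.sum_sum_type]
    simp [hb1, hb2]
  rw [stdGaussian_eq_map_pi_orthonormalBasis b, Measure.map_map (by fun_prop) (by fun_prop),
    chiSq, chiSq, Measure.map_prod_map _ _ (by fun_prop) (by fun_prop),
    ← (measurePreserving_sumPiEquivProdPi
      (fun _ : Fin k ⊕ Fin (n - k) => gaussianReal 0 1)).map_eq,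
    Measure.map_map (by fun_prop) (by fun_prop)]
  congr 1
  funext x
  have hP : T.starProjection (∑ i, x i • b i)
      = ((∑ i, x (.inl i) • b₁ i : T) : EuclideanSpace ℝ (Fin n)) :=
    Submodule.eq_starProjection_of_mem_orthogonal' (SetLike.coe_mem _) (SetLike.coe_mem _) (hsum x)
  simp only [Function.comp_apply, hP]
  rw [hsum, add_sub_cancel_left, ← Submodule.coe_norm, ← Submodule.coe_norm, norm_sq_sum_smul,
    norm_sq_sum_smul]
  rfl

variable {Ω : Type*} [MeasurableSpace Ω] {μ : Measure Ω}
  {ε : Ω → EuclideanSpace ℝ (Fin n)} {σ : ℝ}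

lemma hasLaw_inv_smul (hσ : 0 < σ) (hind : iIndepFun (fun (i : Fin n) ω => ε ω i) μ)
    (hlaw : ∀ i, HasLaw (fun ω => ε ω i) (gaussianReal 0 (σ ^ 2).toNNReal) μ) :
    HasLaw (fun ω => σ⁻¹ • ε ω) (stdGaussian (EuclideanSpace ℝ (Fin n))) μ := by
  have h1 : ∀ i, HasLaw (fun ω => σ⁻¹ * ε ω i) (gaussianReal 0 1) μ := fun i => by
    have := gaussianReal_const_mul (hlaw i) σ⁻¹
    convert this using 2
    · simp
    · ext
      simp only [NNReal.coe_mul, NNReal.coe_mk, NNReal.coe_one]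
      rw [Real.coe_toNNReal _ (sq_nonneg _)]
      field_simp
  have h2 : iIndepFun (fun (i : Fin n) ω => σ⁻¹ * ε ω i) μ :=
    hind.comp (fun _ x => σ⁻¹ * x) fun _ => by fun_prop
  have h3 := h2.hasLaw_pi h1
  have h4 : HasLaw (WithLp.toLp 2) (stdGaussian (EuclideanSpace ℝ (Fin n)))
      (Measure.pi fun _ : Fin n => gaussianReal 0 1) :=
    ⟨by fun_prop, map_pi_eq_stdGaussian⟩
  exact h4.fun_comp h3

/-- The excess is homogeneous of degree two in the noise, which reduces the claim to the standard
Gaussian law. -/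
lemma lintegral_excess (hσ : 0 < σ) (hind : iIndepFun (fun (i : Fin n) ω => ε ω i) μ)
    (hlaw : ∀ i, HasLaw (fun ω => ε ω i) (gaussianReal 0 (σ ^ 2).toNNReal) μ)
    (T : Submodule ℝ (EuclideanSpace ℝ (Fin n))) {k : ℕ} (hk : Module.finrank ℝ T = k) (t : ℝ) :
    ∫⁻ ω, ENNReal.ofReal
        (max (‖T.starProjection (ε ω)‖ ^ 2 - t * ‖ε ω - T.starProjection (ε ω)‖ ^ 2) 0) ∂μ
      = ENNReal.ofReal (σ ^ 2 * excess k (n - k) t) := by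
  have hl := hasLaw_inv_smul hσ hind hlaw
  have h1 : ∀ ω, ENNReal.ofReal
      (max (‖T.starProjection (ε ω)‖ ^ 2 - t * ‖ε ω - T.starProjection (ε ω)‖ ^ 2) 0)
      = ENNReal.ofReal (σ ^ 2) * (fun x => ENNReal.ofReal
        (max (‖T.starProjection x‖ ^ 2 - t * ‖x - T.starProjection x‖ ^ 2) 0)) (σ⁻¹ • ε ω) := by
    intro ω
    have e : ε ω = σ • (σ⁻¹ • ε ω) := by rw [smul_smul, mul_inv_cancel₀ hσ.ne', one_smul]
    generalize σ⁻¹ • ε ω = x at e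
    simp only [e, map_smul, ← smul_sub, norm_smul, mul_pow, Real.norm_eq_abs, sq_abs]
    rw [← ENNReal.ofReal_mul (sq_nonneg _), mul_max_of_nonneg _ _ (sq_nonneg _)]
    ring_nf
  simp_rw [h1]
  rw [lintegral_const_mul' _ _ ENNReal.ofReal_ne_top]
  rw [hl.lintegral_comp (f := fun x => ENNReal.ofReal
      (max (‖T.starProjection x‖ ^ 2 - t * ‖x - T.starProjection x‖ ^ 2) 0))
      (Measurable.aemeasurable (by fun_prop)), ENNReal.ofReal_mul (sq_nonneg _), excess,
    ofReal_integral_eq_lintegral_ofReal (integrable_excess _ _ _)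
      (ae_of_all _ fun _ => le_max_right _ _), ← map_norm_sq_stdGaussian T hk,
    lintegral_map (by fun_prop) (by fun_prop)]

lemma lintegral_norm_sq (hσ : 0 < σ) (hind : iIndepFun (fun (i : Fin n) ω => ε ω i) μ)
    (hlaw : ∀ i, HasLaw (fun ω => ε ω i) (gaussianReal 0 (σ ^ 2).toNNReal) μ) :
    ∫⁻ ω, ENNReal.ofReal (‖ε ω‖ ^ 2) ∂μ = ENNReal.ofReal (σ ^ 2 * n) := by
  -- The case of the whole space with slope `0`: the excess is then `‖ε‖²` itself.
  have h := lintegral_excess hσ hind hlaw ⊤ (k := n) (by simp) 0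
  rw [excess_zero] at h
  rw [← h]
  have h1 : ∀ x : EuclideanSpace ℝ (Fin n),
      (⊤ : Submodule ℝ (EuclideanSpace ℝ (Fin n))).starProjection x = x :=
    fun x => Submodule.starProjection_eq_self_iff.2 Submodule.mem_top
  simp [h1]

end Gaussian

/-! ### Deterministic comparison of loss and penalized residual -/

section Projection

lemma norm_add_sq_le_two_mul {E : Type*} [SeminormedAddCommGroup E] (x y : E) :
    ‖x + y‖ ^ 2 ≤ 2 * ‖x‖ ^ 2 + 2 * ‖y‖ ^ 2 := by
  have := norm_add_le x y
  nlinarith [sq_nonneg (‖x‖ - ‖y‖), norm_nonneg (x + y)]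

variable {E : Type*} [NormedAddCommGroup E] [InnerProductSpace ℝ E] [FiniteDimensional ℝ E]

/-- If `f` already lies in `S`, an arbitrary vector outside `S` is adjoined, so that the dimension
is exactly the one appearing in the penalty. -/
lemma exists_mem_finrank_eq_succ (S : Submodule ℝ E) (h : Module.finrank ℝ S < Module.finrank ℝ E)
    (f : E) : ∃ T : Submodule ℝ E, S ≤ T ∧ f ∈ T ∧ Module.finrank ℝ T = Module.finrank ℝ S + 1 := by
  obtain ⟨v, hv, hf⟩ : ∃ v, v ∉ S ∧ f ∈ S ⊔ Submodule.span ℝ {v} := by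
    by_cases hf : f ∈ S
    · have hS : S ≠ ⊤ := by rintro rfl; simp at h
      obtain ⟨v, -, hv⟩ := SetLike.exists_of_lt (lt_top_iff_ne_top.2 hS)
      exact ⟨v, hv, le_sup_left (α := Submodule ℝ E) hf⟩
    · exact ⟨f, hf, le_sup_right (α := Submodule ℝ E) (Submodule.mem_span_singleton_self f)⟩
  exact ⟨_, le_sup_left, hf, Submodule.finrank_sup_span_singleton hv⟩

lemma norm_sub_starProjection_le (S : Submodule ℝ E) (y : E) {x : E} (hx : x ∈ S) :
    ‖y - S.starProjection y‖ ≤ ‖y - x‖ := by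
  rw [S.starProjection_minimal]
  exact ciInf_le ⟨0, Set.forall_mem_range.2 fun _ => norm_nonneg _⟩ (⟨x, hx⟩ : S)

/-- The vector `Π_S (f + e) - f` lies in `T`, hence is no closer to `e` than `Π_T e`. This lets the
variance estimator dominate the noise outside `T`. -/
lemma norm_sub_starProjection_le_of_le {S T : Submodule ℝ E} (h : S ≤ T) {f : E} (hf : f ∈ T)
    (e : E) : ‖e - T.starProjection e‖ ≤ ‖f + e - S.starProjection (f + e)‖ := by
  have := norm_sub_starProjection_le T e
    (T.sub_mem (h (S.starProjection_apply_mem (f + e))) hf)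
  rwa [sub_sub_eq_add_sub, add_comm e f] at this

lemma inner_eq_inner_starProjection {T : Submodule ℝ E} {x : E} (hx : x ∈ T) (e : E) :
    ⟪e, x⟫ = ⟪T.starProjection e, x⟫ := by
  have := T.starProjection_inner_eq_zero e x hx
  rwa [inner_sub_left, sub_eq_zero] at this

lemma norm_sub_sq_eq_add_inner {T : Submodule ℝ E} {f x : E} (hf : f ∈ T) (hx : x ∈ T) (e : E) :
    ‖f + e - x‖ ^ 2 = ‖f - x‖ ^ 2 + 2 * ⟪T.starProjection e, f - x⟫ + ‖e‖ ^ 2 := by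
  rw [add_sub_right_comm, norm_add_sq_real, real_inner_comm,
    inner_eq_inner_starProjection (T.sub_mem hf hx) e]

variable {S T : Submodule ℝ E} {f : E} {t : ℝ}

/-- The penalized residual of `g` controls its loss from above, up to the excess noise. -/
lemma loss_le_residual (h : S ≤ T) (hf : f ∈ T) (ht : 0 ≤ t) (e g : E) :
    ‖e‖ ^ 2 + ‖f - g‖ ^ 2 / 22
      - 11 / 10 * max (‖T.starProjection e‖ ^ 2 - t * ‖e - T.starProjection e‖ ^ 2) 0
      ≤ ‖f + e - S.starProjection g‖ ^ 2 + (1 / 2 : ℝ) * ‖g - S.starProjection g‖ ^ 2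
        + 11 / 10 * t * ‖f + e - S.starProjection (f + e)‖ ^ 2 := by
  have hp : S.starProjection g ∈ T := h (S.starProjection_apply_mem g)
  set p := S.starProjection g
  rw [norm_sub_sq_eq_add_inner hf hp e]
  have h1 := abs_real_inner_le_norm (T.starProjection e) (f - p)
  have h1' := neg_abs_le ⟪T.starProjection e, f - p⟫
  have h2 := norm_sub_starProjection_le_of_le h hf e
  have h3 : ‖f - g‖ ^ 2 ≤ 2 * ‖f - p‖ ^ 2 + 2 * ‖g - p‖ ^ 2 := by
    have := norm_add_sq_le_two_mul (f - p) (-(g - p))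
    rwa [norm_neg, ← sub_eq_add_neg, sub_sub_sub_cancel_right] at this
  have h4 := le_max_left (‖T.starProjection e‖ ^ 2 - t * ‖e - T.starProjection e‖ ^ 2) 0
  have h5 : t * ‖e - T.starProjection e‖ ^ 2 ≤ t * ‖f + e - S.starProjection (f + e)‖ ^ 2 := by
    gcongr
  -- Young's inequality with weight `11/10`, the factor in the penalty, so that the noise term
  -- matches it exactly. A fraction `1/11` of `‖f - p‖²` survives and, with half of `‖g - p‖²`,
  -- yields `‖f - g‖² / 22` by `h3`.
  have h6 : 2 * (‖T.starProjection e‖ * ‖f - p‖)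
      ≤ 10 / 11 * ‖f - p‖ ^ 2 + 11 / 10 * ‖T.starProjection e‖ ^ 2 := by
    nlinarith [sq_nonneg (10 * ‖f - p‖ - 11 * ‖T.starProjection e‖)]
  have h7 := sq_nonneg ‖g - p‖
  nlinarith

/-- The loss of `g` controls its penalized residual from above, up to the excess noise. -/
lemma residual_le_loss (h : S ≤ T) (hf : f ∈ T) (ht : 0 ≤ t) (e g : E) :
    ‖f + e - S.starProjection g‖ ^ 2 + (1 / 2 : ℝ) * ‖g - S.starProjection g‖ ^ 2
        + 11 / 10 * t * ‖f + e - S.starProjection (f + e)‖ ^ 2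
      ≤ ‖e‖ ^ 2 + (5 + 9 * t) * (‖f - g‖ ^ 2 + ‖g - S.starProjection g‖ ^ 2) + 5 * t * ‖e‖ ^ 2
        + max (‖T.starProjection e‖ ^ 2 - t * ‖e - T.starProjection e‖ ^ 2) 0 := by
  have hp : S.starProjection g ∈ T := h (S.starProjection_apply_mem g)
  have h0 := norm_sub_starProjection_le S (f + e) (S.starProjection_apply_mem g)
  set p := S.starProjection g
  have h1 := abs_real_inner_le_norm (T.starProjection e) (f - p)
  have h1' := le_abs_self ⟪T.starProjection e, f - p⟫
  have h2 := norm_sub_starProjection_le_of_le h hf e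
  have h3 : ‖f - p‖ ^ 2 ≤ 2 * ‖f - g‖ ^ 2 + 2 * ‖g - p‖ ^ 2 := by
    have := norm_add_sq_le_two_mul (f - g) (g - p)
    rwa [sub_add_sub_cancel] at this
  have h3' : ‖f + e - p‖ ^ 2 ≤ 2 * ‖f - p‖ ^ 2 + 2 * ‖e‖ ^ 2 := by
    have := norm_add_sq_le_two_mul (f - p) e
    rwa [sub_add_eq_add_sub] at this
  have h4 := le_max_left (‖T.starProjection e‖ ^ 2 - t * ‖e - T.starProjection e‖ ^ 2) 0
  have h5 : t * ‖e - T.starProjection e‖ ^ 2 ≤ t * ‖f + e - S.starProjection (f + e)‖ ^ 2 := by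
    gcongr
  have h6 : 2 * (‖T.starProjection e‖ * ‖f - p‖) ≤ ‖f - p‖ ^ 2 + ‖T.starProjection e‖ ^ 2 := by
    nlinarith [sq_nonneg (‖f - p‖ - ‖T.starProjection e‖)]
  -- This quantity enters with total coefficient `21/10`: `11/10` from the penalty and `1` from
  -- bounding `‖Π_T e‖²` by `h4` and `h5`. Hence the constants `9 ≥ 42/5` and `5 ≥ 21/5`.
  have h8 : t * ‖f + e - S.starProjection (f + e)‖ ^ 2
      ≤ t * (4 * (‖f - g‖ ^ 2 + ‖g - p‖ ^ 2) + 2 * ‖e‖ ^ 2) := by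
    have : ‖f + e - S.starProjection (f + e)‖ ^ 2 ≤ ‖f + e - p‖ ^ 2 := by gcongr
    gcongr
    linarith
  have h9 : 0 ≤ t * ‖e‖ ^ 2 := by positivity
  have h10 : 0 ≤ t * (‖f - g‖ ^ 2 + ‖g - p‖ ^ 2) := by positivity
  rw [norm_sub_sq_eq_add_inner hf hp e]
  nlinarith [sq_nonneg ‖f - g‖, sq_nonneg ‖g - p‖]

end Projection

/-! ### Summability of the weights -/

section Weights

lemma weight_nonneg {M : ℕ} (m : Finset (Fin M)) : 0 ≤ weight m :=
  add_nonneg (Nat.cast_nonneg _) (Real.log_natCast_nonneg _)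

lemma sum_exp_neg_weight_le (M : ℕ) : ∑ m : Finset (Fin M), Real.exp (-weight m) ≤ 2 := by
  have h := Finset.sum_powerset_apply_card
    (fun k : ℕ => Real.exp (-((k : ℝ) + Real.log (M.choose k)))) (x := (Finset.univ : Finset (Fin M)))
  rw [Finset.powerset_univ, Finset.card_univ, Fintype.card_fin] at h
  simp only [weight]
  rw [h]
  -- The binomial coefficient in the weight cancels the number of sets of cardinality `k`, leaving
  -- `exp (-k) ≤ 2⁻ᵏ`.
  calc _ ≤ ∑ k ∈ Finset.range (M + 1), (1 / 2 : ℝ) ^ k := by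
        refine Finset.sum_le_sum fun k hk => ?_
        have hpos : (0 : ℝ) < M.choose k :=
          by exact_mod_cast Nat.choose_pos (Nat.lt_succ_iff.1 (Finset.mem_range.1 hk))
        rw [neg_add, Real.exp_add, Real.exp_neg (Real.log _), Real.exp_log hpos, nsmul_eq_mul,
          mul_left_comm, mul_inv_cancel₀ hpos.ne', mul_one, Real.exp_neg, ← Real.exp_one_pow,
          one_div, inv_pow]
        gcongr
        linarith [Real.add_one_le_exp (1 : ℝ)]
    _ ≤ 2 := by
        rw [geom_sum_eq (by norm_num), div_le_iff_of_neg (by norm_num)]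
        have : (0 : ℝ) < (1 / 2) ^ (M + 1) := by positivity
        linarith

/-- From `M choose k ≤ Mᵏ / k!` and `kᵏ / k! ≤ exp k`. -/
lemma log_choose_le {M k : ℕ} (hk : 0 < k) (hM : 0 < M) (hkM : k ≤ M) :
    Real.log (M.choose k) ≤ k * Real.log (Real.exp 1 * M / k) := by
  have hk' : (0 : ℝ) < k := by exact_mod_cast hk
  have hM' : (0 : ℝ) < M := by exact_mod_cast hM
  rw [← Real.log_pow]
  refine Real.log_le_log (by exact_mod_cast Nat.choose_pos hkM) ?_
  refine (Nat.choose_le_pow_div k M).trans ?_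
  have h := Real.pow_div_factorial_le_exp (k : ℝ) hk'.le k
  have hf : (0 : ℝ) < k.factorial := by exact_mod_cast k.factorial_pos
  rw [div_le_iff₀ hf] at h
  rw [div_pow, mul_pow, Real.exp_one_pow, div_le_div_iff₀ hf (by positivity)]
  have : (0 : ℝ) ≤ (M : ℝ) ^ k := by positivity
  nlinarith

end Weights

/-! ### Maurey's sparsification -/

section Maurey

variable {ι E : Type*} [NormedAddCommGroup E] [InnerProductSpace ℝ E]

lemma exists_inner_le_of_mem_convexHull {φ : ι → E} {g : E} (hg : g ∈ convexHull ℝ (Set.range φ))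
    (v : E) : ∃ j, ⟪v, φ j⟫ ≤ ⟪v, g⟫ := by
  by_contra! h
  have hconv : Convex ℝ {x : E | ⟪v, g⟫ < ⟪v, x⟫} :=
    convex_halfSpace_gt (f := fun x => ⟪v, x⟫)
      ⟨fun x y => inner_add_right v x y, fun c x => inner_smul_right v x c⟩ _
  have hsub : Set.range φ ⊆ {x : E | ⟪v, g⟫ < ⟪v, x⟫} := Set.range_subset_iff.2 h
  exact lt_irrefl ⟪v, g⟫ (convexHull_min hsub hconv hg)

/-- Maurey's sparsification of a convex combination, in unnormalized form. -/
lemma exists_sparse_sum [DecidableEq ι] {φ : ι → E} {R : ℝ} (hR : ∀ j, ‖φ j‖ ≤ R) {g : E}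
    (hg : g ∈ convexHull ℝ (Set.range φ)) (k : ℕ) :
    ∃ m : Finset ι, m.card ≤ k ∧ (0 < k → m.Nonempty) ∧
      ∃ s ∈ Submodule.span ℝ (φ '' (m : Set ι)), ‖s - k • g‖ ^ 2 ≤ k * R ^ 2 := by
  induction k with
  | zero => exact ⟨∅, by simp, by simp, 0, by simp, by simp⟩
  | succ k ih =>
    obtain ⟨m, hm, -, s, hs, hsg⟩ := ih
    -- Greedy choice in place of random sampling. The extra `- g` in the test vector absorbs the
    -- cross term of `‖φ j - g‖²`, so each step adds at most `‖φ j‖² - ‖g‖² ≤ R²`.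
    obtain ⟨j, hj⟩ := exists_inner_le_of_mem_convexHull hg (s - k • g - g)
    refine ⟨insert j m, (Finset.card_insert_le j m).trans (by omega),
      fun _ => Finset.insert_nonempty j m, s + φ j, ?_, ?_⟩
    · refine Submodule.add_mem _ (Submodule.span_mono (Set.image_mono ?_) hs)
        (Submodule.subset_span ⟨j, by simp, rfl⟩)
      simp
    · have e : s + φ j - (k + 1) • g = (s - k • g) + (φ j - g) := by rw [add_smul, one_smul]; abel
      rw [e, norm_add_sq_real, norm_sub_sq_real (φ j) g, inner_sub_right]
      rw [inner_sub_left, inner_sub_left (s - k • g), real_inner_self_eq_norm_sq] at hj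
      rw [real_inner_comm g (φ j)] at *
      have h1 : ‖φ j‖ ^ 2 ≤ R ^ 2 := by
        have := hR j
        gcongr
      push_cast
      nlinarith [sq_nonneg ‖g‖]

end Maurey

/-! ### Sparse approximation, slopes and the choice of a space for each problem -/

section Approximation

variable {n M : ℕ}

lemma finrank_space_le_card (φ : Fin M → EuclideanSpace ℝ (Fin n)) (m : Finset (Fin M)) :
    Module.finrank ℝ (space φ m) ≤ m.card := by
  classical
  rw [space, ← Finset.coe_image]
  exact (finrank_span_finset_le_card _).trans Finset.card_image_le

lemma finrank_space_mono (φ : Fin M → EuclideanSpace ℝ (Fin n)) (m : Finset (Fin M)) :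
    Module.finrank ℝ (space φ m) ≤ Module.finrank ℝ (space φ Finset.univ) :=
  Submodule.finrank_mono (Submodule.span_mono (Set.image_mono (by simp)))

lemma exists_card_le_norm_sub_starProjection_sq_le {φ : Fin M → EuclideanSpace ℝ (Fin n)} {R : ℝ}
    (hR : ∀ j, ‖φ j‖ ≤ R) {g : EuclideanSpace ℝ (Fin n)}
    (hg : g ∈ convexHull ℝ (Set.range φ)) {k : ℕ} (hk : 0 < k) :
    ∃ m : Finset (Fin M), m.card ≤ k ∧ m.Nonempty ∧
      ‖g - (space φ m).starProjection g‖ ^ 2 ≤ R ^ 2 / k := by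
  obtain ⟨m, hm, hne, s, hs, hsg⟩ := exists_sparse_sum hR hg k
  refine ⟨m, hm, hne hk, ?_⟩
  have hk' : (0 : ℝ) < k := by exact_mod_cast hk
  have h := norm_sub_starProjection_le (space φ m) g
    (Submodule.smul_mem _ (k : ℝ)⁻¹ (show s ∈ space φ m from hs))
  have e : g - (k : ℝ)⁻¹ • s = -((k : ℝ)⁻¹ • (s - k • g)) := by
    rw [← Nat.cast_smul_eq_nsmul ℝ, smul_sub, smul_smul, inv_mul_cancel₀ hk'.ne', one_smul, neg_sub]
  rw [e, norm_neg, norm_smul, norm_inv, Real.norm_of_nonneg hk'.le] at h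
  calc ‖g - (space φ m).starProjection g‖ ^ 2 ≤ ((k : ℝ)⁻¹ * ‖s - k • g‖) ^ 2 := by gcongr
    _ = (k : ℝ)⁻¹ ^ 2 * ‖s - k • g‖ ^ 2 := mul_pow _ _ _
    _ ≤ (k : ℝ)⁻¹ ^ 2 * (k * R ^ 2) := by gcongr
    _ = R ^ 2 / k := by field_simp

/-- The slope `pen_Δ(S_m) / (n - dim S_m)`. -/
noncomputable def slope (φ : Fin M → EuclideanSpace ℝ (Fin n)) (m : Finset (Fin M)) : ℝ :=
  penDelta n (Module.finrank ℝ (space φ m)) (weight m)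
    / ((n : ℝ) - Module.finrank ℝ (space φ m))

/-- The complexity `Δ(S_m) + dim S_m + 1`. -/
noncomputable def complexity (φ : Fin M → EuclideanSpace ℝ (Fin n)) (m : Finset (Fin M)) : ℝ :=
  weight m + Module.finrank ℝ (space φ m) + 1

lemma pen_mul_varEst (φ : Fin M → EuclideanSpace ℝ (Fin n)) (m : Finset (Fin M))
    (y : EuclideanSpace ℝ (Fin n)) :
    pen φ m * varEst φ m y
      = 11 / 10 * slope φ m * ‖y - (space φ m).starProjection y‖ ^ 2 := by
  rw [pen, varEst, slope]
  ring

lemma exp_sub_one_le_mul_exp (s : ℝ) : Real.exp s - 1 ≤ s * Real.exp s := by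
  have h := Real.add_one_le_exp (-s)
  have h2 := mul_le_mul_of_nonneg_right h (Real.exp_pos s).le
  rw [← Real.exp_add, neg_add_cancel, Real.exp_zero] at h2
  linarith

section Slope

variable {φ : Fin M → EuclideanSpace ℝ (Fin n)} {m : Finset (Fin M)}

lemma slope_nonneg (h : Module.finrank ℝ (space φ m) + 2 ≤ n) : 0 ≤ slope φ m := by
  have : (Module.finrank ℝ (space φ m) : ℝ) + 2 ≤ n := by exact_mod_cast h
  exact div_nonneg (penDelta_nonneg _ _ _) (by linarith)

/-- The bound of `penDelta_spec` is exponential in `(Δ + D + 1) / (n - D)`; this ratio is at most `4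
/ q` here, so the exponential can be linearized at the price of `exp (16 / q)`. -/
lemma slope_le (h : Module.finrank ℝ (space φ m) + 2 ≤ n) {q : ℝ} (hq : 0 < q)
    (hqn : q * n ≤ (n : ℝ) - Module.finrank ℝ (space φ m)) (hw : complexity φ m ≤ 4 * n) :
    slope φ m ≤ 8 / q * Real.exp (16 / q) * (complexity φ m / n) := by
  have hn : (0 : ℝ) < n := by exact_mod_cast (by omega : 0 < n)
  have hw0 : 0 ≤ complexity φ m := by
    have := weight_nonneg m
    unfold complexity
    positivity
  refine (penDelta_spec h (weight_nonneg m)).2.trans ?_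
  rw [← complexity]
  set w := complexity φ m
  have hN := lt_of_lt_of_le (mul_pos hq hn) hqn
  have h1 : 4 * w / ((n : ℝ) - Module.finrank ℝ (space φ m)) ≤ 4 * w / (q * n) := by gcongr
  have h2 : 4 * w / (q * n) ≤ 16 / q := by
    rw [div_le_div_iff₀ (by positivity) hq]
    nlinarith
  calc _ ≤ 2 * (4 * w / ((n : ℝ) - Module.finrank ℝ (space φ m))
        * Real.exp (4 * w / ((n : ℝ) - Module.finrank ℝ (space φ m)))) := by
        gcongr
        exact exp_sub_one_le_mul_exp _
    _ ≤ 2 * (4 * w / (q * n) * Real.exp (16 / q)) := by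
        have := h1.trans h2
        gcongr
    _ = _ := by field_simp; ring

end Slope

section Choice

variable {φ : Fin M → EuclideanSpace ℝ (Fin n)} {σ : ℝ}

lemma norm_le_mul_relNorm (hn : 0 < n) (hσ : 0 < σ) (j : Fin M) :
    ‖φ j‖ ≤ σ * (√(n : ℝ) * relNorm φ σ) := by
  have h : ‖φ j‖ / (σ * √(n : ℝ)) ≤ relNorm φ σ :=
    le_ciSup (f := fun j => ‖φ j‖ / (σ * √(n : ℝ))) (Set.finite_range _).bddAbove j
  have : 0 < √(n : ℝ) := Real.sqrt_pos.2 (by exact_mod_cast hn)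
  rw [div_le_iff₀ (by positivity)] at h
  linarith

lemma one_le_log_exp_one_mul {x : ℝ} (hx : 1 ≤ x) : 1 ≤ Real.log (Real.exp 1 * x) := by
  rw [Real.log_mul (Real.exp_ne_zero _) (by positivity), Real.log_exp]
  linarith [Real.log_nonneg hx]

lemma log_exp_one_mul_le {x : ℝ} (hx : 0 < x) : Real.log (Real.exp 1 * x) ≤ x := by
  rw [Real.log_mul (Real.exp_ne_zero _) hx.ne', Real.log_exp]
  linarith [Real.log_le_sub_one_of_pos hx]

/-- `x ↦ x log (e a / x)` is nondecreasing on `(0, a]`. -/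
lemma mul_log_div_mono {a x y : ℝ} (hx : 0 < x) (hxy : x ≤ y) (hya : y ≤ a) :
    x * Real.log (Real.exp 1 * a / x) ≤ y * Real.log (Real.exp 1 * a / y) := by
  have hy := hx.trans_le hxy
  have ha := hy.trans_le hya
  have e : Real.exp 1 * a / x = Real.exp 1 * a / y * (y / x) := by field_simp
  have h1 : 1 ≤ Real.log (Real.exp 1 * a / y) := by
    rw [mul_div_assoc]
    exact one_le_log_exp_one_mul ((one_le_div hy).2 hya)
  rw [e, Real.log_mul (by positivity) (by positivity)]
  have h2 := mul_le_mul_of_nonneg_left (Real.log_le_sub_one_of_pos (div_pos hy hx)) hx.le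
  rw [mul_sub, mul_div_cancel₀ _ hx.ne'] at h2
  nlinarith

/-- Here `M ≤ κ n` enters: it leaves at least `(1 - κ) n` residual degrees of freedom. -/
lemma exists_family_L {κ : ℝ} (hσ : 0 < σ) (hM : 2 ≤ M) (hκ : κ < 1) (hMn : (M : ℝ) ≤ κ * n)
    {L : ℝ} {g : EuclideanSpace ℝ (Fin n)} (hg : g ∈ valueSet φ .L) :
    ∃ m ∈ family n M .L, min (1 - κ) (1 / 2) * n ≤ (n : ℝ) - Module.finrank ℝ (space φ m) ∧
      complexity φ m ≤ 4 * n ∧ σ ^ 2 * complexity φ m ≤ 8 * remainder n M σ L .L ∧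
      ‖g - (space φ m).starProjection g‖ ^ 2 ≤ 2 * remainder n M σ L .L := by
  have hM' : (2 : ℝ) ≤ M := by exact_mod_cast hM
  have hD : (Module.finrank ℝ (space φ Finset.univ) : ℝ) ≤ M := by
    have := finrank_space_le_card φ Finset.univ
    rw [Finset.card_univ, Fintype.card_fin] at this
    exact_mod_cast this
  have hn : (0 : ℝ) ≤ n := Nat.cast_nonneg n
  have hw : complexity φ Finset.univ ≤ 3 * M := by
    simp only [complexity, weight, Finset.card_univ, Fintype.card_fin, Nat.choose_self,
      Nat.cast_one, Real.log_one]
    linarith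
  have hMn' : (M : ℝ) ≤ n := by nlinarith
  refine ⟨Finset.univ, rfl, ?_, by linarith, ?_, ?_⟩
  · have := mul_le_mul_of_nonneg_right (min_le_left (1 - κ) (1 / 2)) hn
    linarith
  · simp only [remainder]
    nlinarith [sq_nonneg σ]
  · rw [Submodule.starProjection_eq_self_iff.2 hg]
    simp only [remainder, sub_self, norm_zero, zero_pow two_ne_zero]
    positivity

lemma exists_family_MS {κ : ℝ} (hσ : 0 < σ) (hn : 4 ≤ n) (hM : 2 ≤ M)
    (hMn : Real.log (Real.exp 1 * M) ≤ (n : ℝ) / 2)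
    {L : ℝ} {g : EuclideanSpace ℝ (Fin n)} (hg : g ∈ valueSet φ .MS) :
    ∃ m ∈ family n M .MS, min (1 - κ) (1 / 2) * n ≤ (n : ℝ) - Module.finrank ℝ (space φ m) ∧
      complexity φ m ≤ 4 * n ∧ σ ^ 2 * complexity φ m ≤ 8 * remainder n M σ L .MS ∧
      ‖g - (space φ m).starProjection g‖ ^ 2 ≤ 2 * remainder n M σ L .MS := by
  have hM' : (2 : ℝ) ≤ M := by exact_mod_cast hM
  have hn' : (4 : ℝ) ≤ n := by exact_mod_cast hn
  obtain ⟨j, hj⟩ := Set.mem_iUnion.1 hg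
  have hD : (Module.finrank ℝ (space φ {j}) : ℝ) ≤ 1 := by
    have := finrank_space_le_card φ {j}
    rw [Finset.card_singleton] at this
    exact_mod_cast this
  have hw : complexity φ {j} ≤ 3 + Real.log M := by
    simp only [complexity, weight, Finset.card_singleton, Nat.choose_one_right, Nat.cast_one]
    linarith
  have hlog : 0.6931471803 < Real.log M :=
    Real.log_two_gt_d9.trans_le (Real.log_le_log two_pos hM')
  rw [Real.log_mul (Real.exp_ne_zero _) (by positivity), Real.log_exp] at hMn
  refine ⟨{j}, ⟨j, rfl⟩, ?_, by linarith, ?_, ?_⟩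
  · have := mul_le_mul_of_nonneg_right (min_le_right (1 - κ) (1 / 2)) (by positivity : (0 : ℝ) ≤ n)
    linarith
  · simp only [remainder]
    nlinarith [sq_nonneg σ]
  · rw [Submodule.starProjection_eq_self_iff.2 hj]
    simp only [remainder, sub_self, norm_zero, zero_pow two_ne_zero]
    have : 0 ≤ Real.log M := by linarith
    positivity

/-- The consequences of the condition `HM` on `r = √n L` and `ℓ = log (e M / r)`. -/
lemma HM.bounds {L : ℝ} (hn : 0 < n) (h : HM n M L) :
    1 ≤ Real.log (Real.exp 1 * M / (√(n : ℝ) * L)) ∧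
    Real.log (Real.exp 1 * M / (√(n : ℝ) * L)) ≤ (√(n : ℝ) * L) ^ 2 ∧
    √(n : ℝ) * L ≤ n / (2 * Real.log (Real.exp 1 * M)) ∧
    √(n : ℝ) * L * √(Real.log (Real.exp 1 * M / (√(n : ℝ) * L))) ≤ M ∧
    ∀ σ, remainder n M σ L .Cv
      = σ ^ 2 * (√(n : ℝ) * L * √(Real.log (Real.exp 1 * M / (√(n : ℝ) * L)))) := by
  obtain ⟨h2, hrM, hM⟩ := h
  have hn0 : (0 : ℝ) < n := by exact_mod_cast hn
  have hs : 0 < √(n : ℝ) := Real.sqrt_pos.2 hn0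
  have hL : 0 < L := pos_of_mul_pos_right (by linarith) hs.le
  have hr2 : (n : ℝ) * L ^ 2 = (√(n : ℝ) * L) ^ 2 := by
    rw [mul_pow, Real.sq_sqrt hn0.le]
  have hr0 : 0 < √(n : ℝ) * L := by positivity
  have hM1 : Real.exp 1 * M ≤ √(n : ℝ) * L * Real.exp (n * L ^ 2) := by
    rw [← div_eq_inv_mul, le_div_iff₀ (Real.exp_pos _), mul_comm] at hM
    exact hM.trans (min_le_left _ _)
  have hM2 : Real.exp 1 * M ≤ Real.exp (√(n : ℝ) / (2 * L)) := by
    rw [← div_eq_inv_mul, le_div_iff₀ (Real.exp_pos _), mul_comm] at hM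
    exact hM.trans (min_le_right _ _)
  have hlogM : 1 ≤ Real.log (Real.exp 1 * M) := one_le_log_exp_one_mul (by linarith)
  -- Taking logarithms in `e M ≤ exp (√n / (2 L))` and multiplying by `2 √n L`.
  have hl2 : √(n : ℝ) * L ≤ n / (2 * Real.log (Real.exp 1 * M)) := by
    have h3 := Real.log_le_log (mul_pos (Real.exp_pos 1) (by linarith)) hM2
    rw [Real.log_exp, le_div_iff₀ (by positivity)] at h3
    rw [le_div_iff₀ (by positivity)]
    nlinarith [Real.mul_self_sqrt hn0.le]
  rw [hr2] at hM1
  have hrem : ∀ σ, remainder n M σ L .Cv = σ ^ 2 * min (M : ℝ)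
      √((√(n : ℝ) * L) ^ 2 * Real.log (Real.exp 1 * M / (√(n : ℝ) * L))) := fun σ => by
    simp only [remainder]
    rw [hr2, Real.sqrt_sq hr0.le]
  generalize √(n : ℝ) * L = r at *
  have hM0 : (0 : ℝ) < M := by linarith
  have hl1 : 1 ≤ Real.log (Real.exp 1 * M / r) := by
    rw [mul_div_assoc]
    exact one_le_log_exp_one_mul ((one_le_div hr0).2 hrM)
  have hlM : r * √(Real.log (Real.exp 1 * M / r)) ≤ M := by
    refine abs_le_of_sq_le_sq' ?_ hM0.le |>.2
    rw [mul_pow, Real.sq_sqrt (by linarith)]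
    -- With `r = √n L`, this gives `r² log (e M / r) ≤ r M ≤ M²`, so the minimum defining `B_Cv` is
    -- its second term.
    have h4 : Real.log (Real.exp 1 * M / r) ≤ M / r := by
      rw [mul_div_assoc]
      exact log_exp_one_mul_le (div_pos hM0 hr0)
    rw [le_div_iff₀ hr0] at h4
    nlinarith
  refine ⟨hl1, ?_, hl2, hlM, fun σ => ?_⟩
  · rw [Real.log_le_iff_le_exp (by positivity), div_le_iff₀ hr0]
    linarith
  · rw [hrem, Real.sqrt_mul (by positivity), Real.sqrt_sq hr0.le, min_eq_right hlM]

/-- With `r = √n L` and `l = log (e M / r)`, a `k`-sparse approximation costs `σ² r² / k` in bias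
and about `σ² k l` in complexity. Taking `k` near `r / √l` makes both of order `σ² r √l = B_Cv`. -/
lemma exists_family_Cv {κ : ℝ} (hσ : 0 < σ) (hn : 4 ≤ n) (hHM : HM n M (relNorm φ σ))
    {g : EuclideanSpace ℝ (Fin n)} (hg : g ∈ valueSet φ .Cv) :
    ∃ m ∈ family n M .Cv, min (1 - κ) (1 / 2) * n ≤ (n : ℝ) - Module.finrank ℝ (space φ m) ∧
      complexity φ m ≤ 4 * n ∧ σ ^ 2 * complexity φ m ≤ 8 * remainder n M σ (relNorm φ σ) .Cv ∧
      ‖g - (space φ m).starProjection g‖ ^ 2 ≤ 2 * remainder n M σ (relNorm φ σ) .Cv := by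
  have hn0 : (0 : ℝ) < n := by exact_mod_cast (by omega : 0 < n)
  obtain ⟨hl1, hlr, hrn, -, hrem⟩ := HM.bounds (by omega) hHM
  have hφ := fun j => norm_le_mul_relNorm (φ := φ) (by omega : 0 < n) hσ j
  obtain ⟨h2, hrM, -⟩ := hHM
  rw [hrem]
  generalize √(n : ℝ) * relNorm φ σ = r at *
  set l := Real.log (Real.exp 1 * M / r) with hl
  have hr0 : 0 < r := by linarith
  have hM0 : (0 : ℝ) < M := by linarith
  have hsl : 1 ≤ √l := Real.one_le_sqrt.2 hl1
  have hsl2 : √l ^ 2 = l := Real.sq_sqrt (by linarith)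
  have hslr : √l ≤ r := (Real.sqrt_le_sqrt hlr).trans_eq (Real.sqrt_sq hr0.le)
  have hx1 : 1 ≤ r / √l := (one_le_div (by linarith)).2 hslr
  have hxr : r / √l ≤ r := div_le_self hr0.le hsl
  -- `l ≤ r²` ensures `k ≥ 1`, and `k ≤ r ≤ n / (2 log (e M))` makes the sparse sets admissible in
  -- the family.
  set k := ⌊r / √l⌋₊
  have hk : 0 < k := Nat.floor_pos.2 hx1
  have hkx : (k : ℝ) ≤ r / √l := Nat.floor_le (by linarith)
  have hxk : r / √l ≤ 2 * k := by
    have h3 := Nat.lt_floor_add_one (r / √l)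
    have h4 : (1 : ℝ) ≤ k := by exact_mod_cast hk
    linarith
  obtain ⟨m, hmk, hne, hm⟩ := exists_card_le_norm_sub_starProjection_sq_le hφ hg hk
  have hmk' : (m.card : ℝ) ≤ k := by exact_mod_cast hmk
  have hm1 : (1 : ℝ) ≤ m.card := by exact_mod_cast hne.card_pos
  have hmn : (m.card : ℝ) ≤ n / (2 * Real.log (Real.exp 1 * M)) := by linarith
  have hlogM : 1 ≤ Real.log (Real.exp 1 * M) := one_le_log_exp_one_mul (by linarith)
  have hmn' := hmn
  rw [le_div_iff₀ (by positivity)] at hmn'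
  have hD : (Module.finrank ℝ (space φ m) : ℝ) ≤ m.card := by
    exact_mod_cast finrank_space_le_card φ m
  have hcM : m.card ≤ M := (Finset.card_le_univ m).trans_eq (Fintype.card_fin M)
  have hlm : 1 ≤ Real.log (Real.exp 1 * M / m.card) := by
    rw [mul_div_assoc]
    refine one_le_log_exp_one_mul ((one_le_div (by linarith)).2 ?_)
    exact_mod_cast hcM
  have hw : complexity φ m ≤ 4 * (m.card * Real.log (Real.exp 1 * M / m.card)) := by
    have := log_choose_le hne.card_pos (by exact_mod_cast hM0) hcM
    simp only [complexity, weight]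
    nlinarith
  -- Monotonicity of `x log (e M / x)` replaces `|m|` by `r / √l`, where the logarithm equals `l +
  -- log l / 2`.
  have hw1 : m.card * Real.log (Real.exp 1 * M / m.card) ≤ 2 * (r * √l) := by
    refine (mul_log_div_mono (by linarith) (hmk'.trans hkx) (hxr.trans hrM)).trans ?_
    have e : Real.exp 1 * M / (r / √l) = Real.exp 1 * M / r * √l := by field_simp
    rw [e, Real.log_mul (by positivity) (by positivity), ← hl, Real.log_sqrt (by linarith)]
    have h5 : l + Real.log l / 2 ≤ 2 * l := by
      have := Real.log_le_sub_one_of_pos (by linarith : 0 < l)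
      linarith
    calc r / √l * (l + Real.log l / 2) ≤ r / √l * (2 * l) := by gcongr
      _ = r / √l * (2 * √l ^ 2) := by rw [hsl2]
      _ = _ := by field_simp
  have hw2 : m.card * Real.log (Real.exp 1 * M / m.card) ≤ n / 2 := by
    have : Real.log (Real.exp 1 * M / m.card) ≤ Real.log (Real.exp 1 * M) :=
      Real.log_le_log (by positivity) (div_le_self (by positivity) hm1)
    nlinarith
  refine ⟨m, ⟨hne, hmn⟩, ?_, by linarith, ?_, hm.trans ?_⟩
  · have := mul_le_mul_of_nonneg_right (min_le_right (1 - κ) (1 / 2)) hn0.le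
    nlinarith
  · nlinarith [sq_nonneg σ]
  · have h6 : (0 : ℝ) < k := by exact_mod_cast hk
    rw [div_le_iff₀ (by linarith)] at hxk
    rw [div_le_iff₀ h6, mul_pow, ← mul_assoc, mul_comm 2, mul_assoc, mul_assoc]
    refine mul_le_mul_of_nonneg_left ?_ (sq_nonneg σ)
    nlinarith

/-- Allows the residual `2σ²` from the expected excesses to be absorbed in the remainder. -/
lemma sq_le_two_mul_remainder (hn : 4 ≤ n) (hM : 2 ≤ M) {L : ℝ} (hHM : HM n M L)
    (σ : ℝ) (lam : Problem) : σ ^ 2 ≤ 2 * remainder n M σ L lam := by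
  have hM' : (2 : ℝ) ≤ M := by exact_mod_cast hM
  cases lam with
  | L =>
    simp only [remainder]
    nlinarith [sq_nonneg σ]
  | MS =>
    have hlog : 0.6931471803 < Real.log M :=
      Real.log_two_gt_d9.trans_le (Real.log_le_log two_pos hM')
    simp only [remainder]
    nlinarith [sq_nonneg σ]
  | Cv =>
    obtain ⟨hl1, -, -, -, hrem⟩ := HM.bounds (by omega) hHM
    have h2 := hHM.1
    rw [hrem]
    have := Real.one_le_sqrt.2 hl1
    have h3 : 1 ≤ √(n : ℝ) * L * √(Real.log (Real.exp 1 * M / (√(n : ℝ) * L))) := by nlinarith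
    nlinarith [sq_nonneg σ]

/-- Every value of the estimator of a compared problem is close to some space of its family whose
complexity is controlled by the remainder. -/
lemma exists_family {κ : ℝ} (hκ : κ < 1) (hσ : 0 < σ) (hn : 4 ≤ n) (hM : 2 ≤ M)
    (hMn : Real.log (Real.exp 1 * M) ≤ (n : ℝ) / 2) (hHM : HM n M (relNorm φ σ))
    {lam : Problem} (hlam : lam ∈ compared κ n M)
    {g : EuclideanSpace ℝ (Fin n)} (hg : g ∈ valueSet φ lam) :
    ∃ m ∈ family n M lam, min (1 - κ) (1 / 2) * n ≤ (n : ℝ) - Module.finrank ℝ (space φ m) ∧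
      complexity φ m ≤ 4 * n ∧ σ ^ 2 * complexity φ m ≤ 8 * remainder n M σ (relNorm φ σ) lam ∧
      ‖g - (space φ m).starProjection g‖ ^ 2 ≤ 2 * remainder n M σ (relNorm φ σ) lam := by
  cases lam with
  | L => exact exists_family_L hσ hM hκ (hlam rfl) hg
  | MS => exact exists_family_MS hσ hn hM hMn hg
  | Cv => exact exists_family_Cv hσ hn hHM hg

/-- An infimum of reals over an empty family would be `0`, and the lower bound on the criterion
would fail. For Cv, `log (e M) ≤ n / 2` is what admits singletons. -/
lemma nonempty_family (hM : 2 ≤ M) (hMn : Real.log (Real.exp 1 * M) ≤ (n : ℝ) / 2)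
    (lam : Problem) : Nonempty (family n M lam) := by
  let j : Fin M := ⟨0, by omega⟩
  cases lam with
  | L => exact ⟨Finset.univ, rfl⟩
  | MS => exact ⟨{j}, j, rfl⟩
  | Cv =>
    refine ⟨{j}, Finset.singleton_nonempty j, ?_⟩
    have hM' : (2 : ℝ) ≤ M := by exact_mod_cast hM
    have := one_le_log_exp_one_mul (by linarith : (1 : ℝ) ≤ M)
    rw [Finset.card_singleton, Nat.cast_one, le_div_iff₀ (by positivity)]
    linarith

end Choice

end Approximation

/-! ### From the criterion to the risk bound -/

section Oracle

variable {n M : ℕ}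

/-- One `Z` dominating every excess makes the bound uniform in `m`, hence usable at the
data-dependent selected problem. -/
lemma le_crit {φ : Fin M → EuclideanSpace ℝ (Fin n)} {lam : Problem} [Nonempty (family n M lam)]
    {T : Finset (Fin M) → Submodule ℝ (EuclideanSpace ℝ (Fin n))}
    {f : EuclideanSpace ℝ (Fin n)} (hT : ∀ m, space φ m ≤ T m) (hf : ∀ m, f ∈ T m)
    (ht : ∀ m, 0 ≤ slope φ m) {e : EuclideanSpace ℝ (Fin n)} {Z : ℝ}
    (hZ : ∀ m, max (‖(T m).starProjection e‖ ^ 2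
      - slope φ m * ‖e - (T m).starProjection e‖ ^ 2) 0 ≤ Z) (g : EuclideanSpace ℝ (Fin n)) :
    ‖e‖ ^ 2 + ‖f - g‖ ^ 2 / 22 - 11 / 10 * Z ≤ crit φ lam (f + e) g := by
  refine le_ciInf fun m => ?_
  rw [pen_mul_varEst]
  have := loss_le_residual (hT m) (hf m) (ht m) e g
  linarith [hZ m]

lemma crit_le {φ : Fin M → EuclideanSpace ℝ (Fin n)} {lam : Problem}
    {T : Finset (Fin M) → Submodule ℝ (EuclideanSpace ℝ (Fin n))}
    {f : EuclideanSpace ℝ (Fin n)} (hT : ∀ m, space φ m ≤ T m) (hf : ∀ m, f ∈ T m)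
    (ht : ∀ m, 0 ≤ slope φ m) {e : EuclideanSpace ℝ (Fin n)} {Z : ℝ}
    (hZ : ∀ m, max (‖(T m).starProjection e‖ ^ 2
      - slope φ m * ‖e - (T m).starProjection e‖ ^ 2) 0 ≤ Z) (g : EuclideanSpace ℝ (Fin n))
    {m : Finset (Fin M)} (hm : m ∈ family n M lam) :
    crit φ lam (f + e) g ≤ ‖e‖ ^ 2
      + (5 + 9 * slope φ m) * (‖f - g‖ ^ 2 + ‖g - (space φ m).starProjection g‖ ^ 2)
      + 5 * slope φ m * ‖e‖ ^ 2 + Z := by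
  refine (ciInf_le (Set.finite_range _).bddBelow (⟨m, hm⟩ : family n M lam)).trans ?_
  rw [pen_mul_varEst]
  have := residual_le_loss (hT m) (hf m) (ht m) e g
  linarith [hZ m]

/-- The constant of the risk bound. -/
noncomputable def riskConst (κ : ℝ) : ℝ :=
  22 * (5 + 40 * (8 / min (1 - κ) (1 / 2) * Real.exp (16 / min (1 - κ) (1 / 2))))

lemma riskConst_pos {κ : ℝ} (hκ : κ < 1) : 0 < riskConst κ := by
  have : 0 < min (1 - κ) (1 / 2) := lt_min (by linarith) (by norm_num)
  unfold riskConst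
  positivity

/-- The pointwise risk bound for the selected estimator. -/
lemma norm_sub_sq_le {κ : ℝ} (hκ : κ < 1) {σ : ℝ} {φ : Fin M → EuclideanSpace ℝ (Fin n)}
    (hn : 4 ≤ n) (hM : 2 ≤ M) (hσ : 0 < σ)
    (hdim : Module.finrank ℝ (space φ Finset.univ) + 2 ≤ n)
    (hHM : HM n M (relNorm φ σ)) (hMn : Real.log (Real.exp 1 * M) ≤ (n : ℝ) / 2)
    {T : Finset (Fin M) → Submodule ℝ (EuclideanSpace ℝ (Fin n))}
    {f : EuclideanSpace ℝ (Fin n)} (hT : ∀ m, space φ m ≤ T m) (hf : ∀ m, f ∈ T m)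
    {e : EuclideanSpace ℝ (Fin n)} {Z : ℝ}
    (hZ : ∀ m, max (‖(T m).starProjection e‖ ^ 2
      - slope φ m * ‖e - (T m).starProjection e‖ ^ 2) 0 ≤ Z)
    {lam lam' : Problem} (hlam : lam ∈ compared κ n M) {g g' : EuclideanSpace ℝ (Fin n)}
    (hg : g ∈ valueSet φ lam) (hcrit : crit φ lam' (f + e) g' ≤ crit φ lam (f + e) g) :
    ‖f - g'‖ ^ 2 ≤ riskConst κ * (‖f - g‖ ^ 2 + 2 * remainder n M σ (relNorm φ σ) lam
      + remainder n M σ (relNorm φ σ) lam / (σ ^ 2 * n) * ‖e‖ ^ 2 + Z) := by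
  have hdim' : ∀ m, Module.finrank ℝ (space φ m) + 2 ≤ n := fun m =>
    (Nat.add_le_add_right (finrank_space_mono φ m) 2).trans hdim
  have ht : ∀ m, 0 ≤ slope φ m := fun m => slope_nonneg (hdim' m)
  have := nonempty_family hM hMn lam'
  obtain ⟨m, hm, hq, hw, hwB, hgB⟩ := exists_family hκ hσ hn hM hMn hHM hlam hg
  have h1 := le_crit (lam := lam') hT hf ht hZ g'
  have h2 := crit_le hT hf ht hZ g hm
  have hq0 : 0 < min (1 - κ) (1 / 2) := lt_min (by linarith) (by norm_num)
  have h3 := slope_le (hdim' m) hq0 hq hw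
  have hn0 : (0 : ℝ) < n := by exact_mod_cast (by omega : 0 < n)
  have hB : 0 ≤ remainder n M σ (relNorm φ σ) lam := by
    linarith [sq_nonneg ‖g - (space φ m).starProjection g‖]
  have hZ0 : 0 ≤ Z := (le_max_right _ _).trans (hZ m)
  have htm := ht m
  rw [riskConst]
  set A := 8 / min (1 - κ) (1 / 2) * Real.exp (16 / min (1 - κ) (1 / 2))
  have hA : 0 < A := by positivity
  set B := remainder n M σ (relNorm φ σ) lam
  set t := slope φ m
  have h4 : t ≤ 4 * A := by
    -- Two bounds on the slope are needed: a constant one here, for the factor of the loss, and one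
    -- proportional to `B / (σ² n)` in `h5`, for the factor of `‖e‖²`, which is of order `σ² n`.
    have : complexity φ m / n ≤ 4 := (div_le_iff₀ hn0).2 hw
    nlinarith
  have h5 : t ≤ 8 * A * (B / (σ ^ 2 * n)) := by
    have : complexity φ m / n ≤ 8 * (B / (σ ^ 2 * n)) := by
      rw [mul_div_assoc', div_le_div_iff₀ hn0 (by positivity)]
      nlinarith
    nlinarith
  have h6 : t * ‖e‖ ^ 2 ≤ 8 * A * (B / (σ ^ 2 * n)) * ‖e‖ ^ 2 := by gcongr
  have h7 : (5 + 9 * t) * (‖f - g‖ ^ 2 + ‖g - (space φ m).starProjection g‖ ^ 2)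
      ≤ (5 + 40 * A) * (‖f - g‖ ^ 2 + 2 * B) := by
    gcongr ?_ * (_ + ?_)
    linarith
  have h8 : 0 ≤ B / (σ ^ 2 * n) * ‖e‖ ^ 2 := by positivity
  have h9 : 0 ≤ A * Z := by positivity
  linarith

variable {Ω : Type*} [MeasurableSpace Ω] {μ : Measure Ω}
  {ε : Ω → EuclideanSpace ℝ (Fin n)} {σ : ℝ}

/-- By the equation defining the penalty, each term has mean `σ² exp (-Δ(m))`; the choice of `T m`
matters only through its dimension. -/
lemma lintegral_sum_excess_le (hσ : 0 < σ) (hind : iIndepFun (fun (i : Fin n) ω => ε ω i) μ)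
    (hlaw : ∀ i, HasLaw (fun ω => ε ω i) (gaussianReal 0 (σ ^ 2).toNNReal) μ)
    (hε : AEMeasurable ε μ)
    {φ : Fin M → EuclideanSpace ℝ (Fin n)} (hdim : ∀ m, Module.finrank ℝ (space φ m) + 2 ≤ n)
    {T : Finset (Fin M) → Submodule ℝ (EuclideanSpace ℝ (Fin n))}
    (hT : ∀ m, Module.finrank ℝ (T m) = Module.finrank ℝ (space φ m) + 1) :
    ∫⁻ ω, ENNReal.ofReal (∑ m, max (‖(T m).starProjection (ε ω)‖ ^ 2
        - slope φ m * ‖ε ω - (T m).starProjection (ε ω)‖ ^ 2) 0) ∂μ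
      ≤ ENNReal.ofReal (2 * σ ^ 2) := by
  simp_rw [ENNReal.ofReal_sum_of_nonneg fun _ _ => le_max_right _ _]
  rw [lintegral_finsetSum' _ fun m _ => by fun_prop]
  have h : ∀ m, ∫⁻ ω, ENNReal.ofReal (max (‖(T m).starProjection (ε ω)‖ ^ 2
        - slope φ m * ‖ε ω - (T m).starProjection (ε ω)‖ ^ 2) 0) ∂μ
      = ENNReal.ofReal (σ ^ 2 * Real.exp (-weight m)) := fun m => by
    rw [lintegral_excess hσ hind hlaw (T m) (hT m), ← (penDelta_spec (hdim m) (weight_nonneg m)).1,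
      slope, Nat.sub_sub]
  simp_rw [h]
  rw [← ENNReal.ofReal_sum_of_nonneg fun _ _ => by positivity, ← Finset.mul_sum]
  refine ENNReal.ofReal_le_ofReal ?_
  nlinarith [sum_exp_neg_weight_le M, sq_nonneg σ]

lemma aemeasurable_noise (hσ : 0 < σ) (hind : iIndepFun (fun (i : Fin n) ω => ε ω i) μ)
    (hlaw : ∀ i, HasLaw (fun ω => ε ω i) (gaussianReal 0 (σ ^ 2).toNNReal) μ) :
    AEMeasurable ε μ := by
  have h := ((hasLaw_inv_smul hσ hind hlaw).aemeasurable).const_smul σ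
  refine h.congr (ae_of_all _ fun ω => ?_)
  rw [Pi.smul_apply, smul_smul, mul_inv_cancel₀ hσ.ne', one_smul]

lemma risk_le {κ : ℝ} (hκ : κ < 1) {φ : Fin M → EuclideanSpace ℝ (Fin n)}
    (hn : 4 ≤ n) (hM : 2 ≤ M) (hσ : 0 < σ)
    (hdim : Module.finrank ℝ (space φ Finset.univ) + 2 ≤ n)
    (hHM : HM n M (relNorm φ σ)) (hMn : Real.log (Real.exp 1 * M) ≤ (n : ℝ) / 2)
    (f : EuclideanSpace ℝ (Fin n)) [IsProbabilityMeasure μ]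
    (hind : iIndepFun (fun (i : Fin n) ω => ε ω i) μ)
    (hlaw : ∀ i, HasLaw (fun ω => ε ω i) (gaussianReal 0 (σ ^ 2).toNNReal) μ)
    {fhat : Problem → Ω → EuclideanSpace ℝ (Fin n)} {sel : Ω → Problem}
    (hmeas : ∀ lam, Measurable (fhat lam)) (hval : ∀ lam ω, fhat lam ω ∈ valueSet φ lam)
    (hsel : ∀ ω lam, crit φ (sel ω) (f + ε ω) (fhat (sel ω) ω)
      ≤ crit φ lam (f + ε ω) (fhat lam ω))
    {lam : Problem} (hlam : lam ∈ compared κ n M) :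
    risk μ f (fun ω => fhat (sel ω) ω) ≤ ENNReal.ofReal (7 * riskConst κ) *
      (risk μ f (fhat lam) + ENNReal.ofReal (remainder n M σ (relNorm φ σ) lam)) := by
  have hdim' : ∀ m, Module.finrank ℝ (space φ m) + 2 ≤ n := fun m =>
    (Nat.add_le_add_right (finrank_space_mono φ m) 2).trans hdim
  have hε := aemeasurable_noise hσ hind hlaw
  have hC := riskConst_pos hκ
  have hn0 : (0 : ℝ) < n := by exact_mod_cast (by omega : 0 < n)
  have hσB := sq_le_two_mul_remainder hn hM hHM σ lam
  have hB : 0 ≤ remainder n M σ (relNorm φ σ) lam := by linarith [sq_nonneg σ]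
  choose T hT hf hTd using fun m => exists_mem_finrank_eq_succ (space φ m)
    (by rw [finrank_euclideanSpace_fin]; have := hdim' m; omega) f
  let Z := fun ω => ∑ m, max (‖(T m).starProjection (ε ω)‖ ^ 2
        - slope φ m * ‖ε ω - (T m).starProjection (ε ω)‖ ^ 2) 0
  have hZm : ∀ ω m, max (‖(T m).starProjection (ε ω)‖ ^ 2
        - slope φ m * ‖ε ω - (T m).starProjection (ε ω)‖ ^ 2) 0 ≤ Z ω := fun ω m =>
    Finset.single_le_sum (f := fun m => max (‖(T m).starProjection (ε ω)‖ ^ 2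
        - slope φ m * ‖ε ω - (T m).starProjection (ε ω)‖ ^ 2) 0)
      (fun _ _ => le_max_right _ _) (Finset.mem_univ m)
  have hZ0 : ∀ ω, 0 ≤ Z ω := fun ω => Finset.sum_nonneg fun _ _ => le_max_right _ _
  have hZ : ∫⁻ ω, ENNReal.ofReal (Z ω) ∂μ ≤ ENNReal.ofReal (2 * σ ^ 2) :=
    lintegral_sum_excess_le hσ hind hlaw hε hdim' hTd
  set B := remainder n M σ (relNorm φ σ) lam
  have hpt : ∀ ω, ENNReal.ofReal (‖f - fhat (sel ω) ω‖ ^ 2) ≤ ENNReal.ofReal (riskConst κ) *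
      (ENNReal.ofReal (‖f - fhat lam ω‖ ^ 2) + (ENNReal.ofReal (2 * B)
        + (ENNReal.ofReal (B / (σ ^ 2 * n)) * ENNReal.ofReal (‖ε ω‖ ^ 2)
          + ENNReal.ofReal (Z ω)))) := fun ω => by
    have hz := hZ0 ω
    rw [← ENNReal.ofReal_mul (by positivity), ← ENNReal.ofReal_add (by positivity) hz,
      ← ENNReal.ofReal_add (by positivity) (by positivity),
      ← ENNReal.ofReal_add (by positivity) (by positivity), ← ENNReal.ofReal_mul hC.le]
    refine ENNReal.ofReal_le_ofReal ((norm_sub_sq_le hκ hn hM hσ hdim hHM hMn hT hf (hZm ω) hlam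
      (hval lam ω) (hsel ω lam)).trans_eq ?_)
    ring
  calc risk μ f (fun ω => fhat (sel ω) ω)
      ≤ ENNReal.ofReal (riskConst κ) * (risk μ f (fhat lam) + (ENNReal.ofReal (2 * B)
          + (ENNReal.ofReal (B / (σ ^ 2 * n)) * ENNReal.ofReal (σ ^ 2 * n)
            + ENNReal.ofReal (2 * σ ^ 2)))) := by
        have hm := hmeas lam
        refine (lintegral_mono hpt).trans ?_
        rw [lintegral_const_mul' _ _ ENNReal.ofReal_ne_top, lintegral_add_left (by fun_prop),
          lintegral_add_left (by fun_prop), lintegral_const, measure_univ, mul_one,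
          lintegral_add_left' (by fun_prop), lintegral_const_mul' _ _ ENNReal.ofReal_ne_top,
          lintegral_norm_sq hσ hind hlaw, risk]
        gcongr
    -- As `E ‖ε‖² = σ² n`, the error is `2 B + B + 2 σ²`, and `σ² ≤ 2 B` gives `7 B`.
    _ ≤ ENNReal.ofReal (riskConst κ) * (risk μ f (fhat lam) + ENNReal.ofReal (7 * B)) := by
        rw [← ENNReal.ofReal_mul (by positivity), div_mul_cancel₀ _ (by positivity),
          ← ENNReal.ofReal_add hB (by positivity), ← ENNReal.ofReal_add (by positivity)
            (by positivity)]
        gcongr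
        linarith
    _ ≤ _ := by
        rw [mul_comm 7 (riskConst κ), ENNReal.ofReal_mul hC.le, ENNReal.ofReal_mul (by norm_num), mul_assoc,
          mul_add (ENNReal.ofReal 7)]
        gcongr
        refine le_mul_of_one_le_left' ?_
        rw [ENNReal.one_le_ofReal]
        norm_num

lemma bias_nonneg (φ : Fin M → EuclideanSpace ℝ (Fin n)) (f : EuclideanSpace ℝ (Fin n))
    (lam : Problem) : 0 ≤ bias φ f lam :=
  Real.iInf_nonneg fun _ => sq_nonneg _

end Oracle

end GaussianAggregation

open GaussianAggregation in
theorem proposition3 (κ : ℝ) (hκ0 : 0 < κ) (hκ1 : κ < 1) :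
    ∃ C : ℝ, 0 < C ∧ ∀ C' : ℝ, 0 < C' → ∃ C'' : ℝ, 0 < C'' ∧
      ∀ (n M : ℕ) (σ : ℝ) (φ : Fin M → EuclideanSpace ℝ (Fin n)),
        4 ≤ n → 2 ≤ M → 0 < σ →
        -- the dimension of the largest space is at most `n - 2`
        Module.finrank ℝ (space φ Finset.univ) + 2 ≤ n →
        HM n M (relNorm φ σ) →
        Real.log (Real.exp 1 * M) ≤ (n : ℝ) / 2 →
        ∀ (f : EuclideanSpace ℝ (Fin n))
          (Ω : Type*) (_ : MeasurableSpace Ω) (μ : Measure Ω) (_ : IsProbabilityMeasure μ)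
          (ε : Ω → EuclideanSpace ℝ (Fin n))
          (fhat : Problem → Ω → EuclideanSpace ℝ (Fin n)) (sel : Ω → Problem),
          iIndepFun (fun (i : Fin n) ω => ε ω i) μ →
          (∀ i, HasLaw (fun ω => ε ω i) (gaussianReal 0 (σ ^ 2).toNNReal) μ) →
          (∀ lam, Measurable (fhat lam)) →
          (∀ lam ω, fhat lam ω ∈ valueSet φ lam) →
          -- the selected index minimizes the criterion at the observation `Y = f + ε`
          (∀ ω lam, crit φ (sel ω) (f + ε ω) (fhat (sel ω) ω)
            ≤ crit φ lam (f + ε ω) (fhat lam ω)) →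
          Measurable (fun ω => fhat (sel ω) ω) →
          ENNReal.ofReal C * risk μ f (fun ω => fhat (sel ω) ω)
              ≤ ⨅ lam ∈ compared κ n M,
                  (risk μ f (fhat lam) + ENNReal.ofReal (remainder n M σ (relNorm φ σ) lam)) ∧
          ((∀ lam ∈ compared κ n M,
              risk μ f (fhat lam)
                ≤ ENNReal.ofReal (bias φ f lam + C' * remainder n M σ (relNorm φ σ) lam)) →
            ENNReal.ofReal C'' * risk μ f (fun ω => fhat (sel ω) ω)
              ≤ ⨅ lam ∈ compared κ n M,
                  ENNReal.ofReal (bias φ f lam + remainder n M σ (relNorm φ σ) lam)) := by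

  have hR := riskConst_pos hκ1
  have hC : 0 < (7 * riskConst κ)⁻¹ := by positivity
  -- Under the additional risk hypothesis the right-hand side becomes `bias + (1 + C') B ≤ (1 + C')
  -- (bias + B)`, whence the factor `(1 + C')⁻¹`.
  refine ⟨(7 * riskConst κ)⁻¹, hC, fun C' hC' =>
    ⟨(7 * riskConst κ)⁻¹ * (1 + C')⁻¹, by positivity, ?_⟩⟩
  intro n M σ φ hn hM hσ hdim hHM hMn f Ω _ μ _ ε fhat sel hind hlaw hmeas hval hsel _
  have hrisk : ∀ lam ∈ compared κ n M,
      ENNReal.ofReal (7 * riskConst κ)⁻¹ * risk μ f (fun ω => fhat (sel ω) ω)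
        ≤ risk μ f (fhat lam) + ENNReal.ofReal (remainder n M σ (relNorm φ σ) lam) :=
    fun lam hlam => by
    rw [ENNReal.ofReal_inv_of_pos (by positivity),
      ENNReal.inv_mul_le_iff (by positivity) ENNReal.ofReal_ne_top]
    exact risk_le hκ1 hn hM hσ hdim hHM hMn f hind hlaw hmeas hval hsel hlam
  refine ⟨le_iInf₂ hrisk, fun hbias => le_iInf₂ fun lam hlam => ?_⟩
  have hB : 0 ≤ remainder n M σ (relNorm φ σ) lam := by
    linarith [sq_le_two_mul_remainder hn hM hHM σ lam, sq_nonneg σ]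
  have hb := bias_nonneg φ f lam
  rw [mul_comm (7 * riskConst κ)⁻¹, ENNReal.ofReal_mul (by positivity), mul_assoc,
    ENNReal.ofReal_inv_of_pos (by positivity),
    ENNReal.inv_mul_le_iff (by positivity) ENNReal.ofReal_ne_top,
    ← ENNReal.ofReal_mul (by positivity)]
  refine (hrisk lam hlam).trans ?_
  refine (add_le_add_left (hbias lam hlam) _).trans ?_
  rw [← ENNReal.ofReal_add (by positivity) hB]
  refine ENNReal.ofReal_le_ofReal ?_
  nlinarith
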